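/- **Timing game.** There are $n$ validators, a quorum size $1\le c\le n$, a rank $m\le n-1$ and a timeout $\tau$. In every round a leader is drawn uniformly at random. If $i$ leads a round and $j$ led the previous one, $i$ becomes able to propose a time $s$ after $j$'s broadcast, namely when $i$ holds $j$'s block and $c$ votes on it ($s=0$ in the first round, which starts at time $0$). An oracle tells $i$ the largest delay $\Delta^*$ for which at least $c$ validators observe a round duration of at most $\tau$, and $i$ broadcasts after a delay $\Delta\in[0,\Delta^*]$ that may depend on all that $i$ has observed. Each $k\ne i$ then casts a timeliness vote, a function of the times at which $k$ received the blocks so far; the observed round duration of $k$ is the time between its receipts of the previous block (the start of the game, in the first round) and the current one. With $v^*$ the $m$-th smallest of these $n-1$ votes, $i$ receives $M(\Delta+s)+B(v^*)$. The utility of a validator is the expectation of the long-run limit (upper limit, if the limit does not exist) of its total reward divided by the total duration $\sum(\Delta+s)$ of the rounds. Latencies are hidden from the validators. Let $L_{i\to k}\ge 0$ be the random latency of a message from $i$ to $k$. The latencies of a round (for block messages and for vote messages) have a fixed joint law, and rounds are independent and identically distributed. Write $$S^{j,i}=\max\bigl(Q^{j\to i}_c,\;L_{j\to i}\bigr),$$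 where $Q^{j\to i}_c$ is the $c$-th smallest of $\{L_{j\to k}+L_{k\to i}\}_{k}$ (block latency from $j$ plus vote latency to $i$, in the round led by $j$), and let $E^{i-j}_m$ be the $m$-th smallest of $\{L_{i\to k}-L_{j\to k}\}_{k\neq i}$ (block latencies from $j$ in the round led by $j$ and from $i$ in the next round). Let $\sigma^*$ be the profile in which every leader proposes without delay and every voter reports its observed round duration. **Assumptions.** On $[0,\infty)$, $M$ is nonnegative and increasing and $B(x)=b\tau-bx$ with $b\ge0$. Almost surely $\Delta^*\ge0$ (a leader who does not delay is not timed out), and $S^{j,i}+E^{i-j}_m\le\tau$ for all $i,j$ (without delay, the aggregated vote does not exceed $\tau$). Every $S^{j,k}$ is integrable, and $\sum_{j,k}\mathbb E[S^{j,k}]>0$. **Theorem.** Suppose that $\langle M,B\rangle$ is time-decreasing, i.e. $M(x)+B(x)$ is decreasing in $x\ge0$, and that $m>n-c$. Then $\sigma^*$ is a subgame-perfect Bayes–Nash equilibrium: at every decision node, on or off the path of play, and for every belief about the past, no validator can increase its expected utility by unilaterally changing its strategy. Moreover, under $\sigma^*$ the long-run time-averaged reward of each validator $i$ converges almost surely,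 and it and the utility of $i$ are equal to $$U_i(\sigma^*)=\frac{\sum_{j}\Bigl(\mathbb E\bigl[M(S^{j,i})\bigr]+\mathbb E\bigl[B(S^{j,i}+E^{i-j}_m)\bigr]\Bigr)}{\sum_{j,k}\mathbb E\bigl[S^{j,k}\bigr]}.$$ ("Increasing" and "decreasing" are meant in the weak sense.) -/

import Mathlib

open MeasureTheory Filter Topology
open scoped NNReal

noncomputable section

namespace Timing

/-! ### Latencies and the derived random variables -/

/-- A matrix of realized latencies: `l i k` is the latency of a message from `i` to `k`. -/
abbrev Latencies (n : ℕ) := Fin n → Fin n → ℝ≥0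

/-- The latencies of one round: `d.1 i k` is the time the block of that round needs to get from its
proposer `i` to `k`; `d.2 k i` is the time the vote of `k` on that block needs to get from `k` to
the next proposer `i`. -/
abbrev Draw (n : ℕ) := Latencies n × Latencies n

/-- Nature's move in one round: the leader and the latencies. -/
abbrev Move (n : ℕ) := Fin n × Draw n

/-- The `x`-th order statistic (`x`-th smallest value, counted from `1` and with multiplicity) of the
family `(f k)`, `k ∈ s`: the least `t` such that at least `x` of the values are `≤ t`.
Meaningful for `1 ≤ x ≤ #s`. -/
def orderStat {ι : Type*} (s : Finset ι) (f : ι → ℝ) (x : ℕ) : ℝ :=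
  sInf {t : ℝ | x ≤ (s.filter fun k => f k ≤ t).card}

variable {n : ℕ}

/-- `Q_c^{j → i}`: the time, after `j` broadcasts its block, at which `i` holds `c` votes on it. -/
def quorumTime (c : ℕ) (d : Draw n) (j i : Fin n) : ℝ :=
  orderStat Finset.univ (fun k => (d.1 j k : ℝ) + d.2 k i) c

/-- `S^{j,i} = max (Q_c^{j → i}, L_{j → i})`: the time, after `j` broadcasts its block, at which the
next leader `i` holds both the block and a quorum of votes. -/
def startTime (c : ℕ) (d : Draw n) (j i : Fin n) : ℝ :=
  max (quorumTime c d j i) (d.1 j i)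

/-- `L_{i → k} - L_{j → k}`, where `d` are the latencies of the round led by `j` and `d'` those of
the following round, led by `i`. -/
def latencyGap (d d' : Draw n) (j i k : Fin n) : ℝ := (d'.1 i k : ℝ) - d.1 j k

/-- `E_m^{i-j}`: the `m`-th order statistic of the latency differences over the timeliness voters,
that is, over all validators other than the leader `i`. -/
def voteError (m : ℕ) (d d' : Draw n) (j i : Fin n) : ℝ :=
  orderStat (Finset.univ.erase i) (latencyGap d d' j i) m

/-- `Δ* = τ - S^{j,i} - E_c^{i-j}`: the largest delay of the leader `i`, preceded by `j`, for which at
least `c` validators observe a round duration of at most `τ`. -/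
def maxDelay (τ : ℝ) (c : ℕ) (d d' : Draw n) (j i : Fin n) : ℝ :=
  τ - startTime c d j i - orderStat Finset.univ (latencyGap d d' j i) c

/-- `Δ*` in the first round, which starts at time `0` and has no previous block. -/
def maxDelayFirst (τ : ℝ) (c : ℕ) (d : Draw n) (i : Fin n) : ℝ :=
  τ - orderStat Finset.univ (fun k => (d.1 i k : ℝ)) c

/-! ### The data of the game -/

/-- The data of a timing game with `n` validators. -/
structure Game (n : ℕ) where
  /-- quorum size -/
  c : ℕ
  /-- rank of the order statistic that aggregates the timeliness votes -/
  m : ℕ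
  /-- timeout -/
  τ : ℝ
  /-- MEV reward -/
  M : ℝ → ℝ
  /-- block reward -/
  B : ℝ → ℝ
  /-- joint law of the latencies of one round; the law of the entry `(i, k)` is `L_{i → k}` -/
  lat : Measure (Draw n)

/-- The law of nature's move in a round: a uniformly random leader, and independent latencies. -/
def Game.moveLaw [NeZero n] (G : Game n) : Measure (Move n) :=
  (PMF.uniformOfFintype (Fin n)).toMeasure.prod G.lat

/-- The law of nature's moves in all rounds: independent and identically distributed. -/
def Game.pathLaw [NeZero n] (G : Game n) : Measure (ℕ → Move n) :=
  Measure.infinitePi fun _ : ℕ => G.moveLaw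

/-! ### Timeline

Rounds are numbered from `0`.  A path `ω` lists nature's moves.  The actions of a round are the delay
of its leader and the published votes. -/

/-- The actions of a round: the delay of the leader, and the timeliness votes. -/
abbrev Action (n : ℕ) := ℝ × (Fin n → ℝ)

/-- `s`: the time between the previous broadcast (the start of the game, for the first round) and
the moment at which the leader of round `r` is able to propose. -/
def start (G : Game n) (ω : ℕ → Move n) : ℕ → ℝ
  | 0 => 0
  | r + 1 => startTime G.c (ω r).2 (ω r).1 (ω (r + 1)).1

/-- The largest delay `Δ*` in round `r`. -/
def cap (G : Game n) (ω : ℕ → Move n) : ℕ → ℝ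
  | 0 => maxDelayFirst G.τ G.c (ω 0).2 (ω 0).1
  | r + 1 => maxDelay G.τ G.c (ω r).2 (ω (r + 1)).2 (ω r).1 (ω (r + 1)).1

/-- The time at which the block of round `r` is broadcast, when `h` are the actions taken. -/
def broadcast (G : Game n) (ω : ℕ → Move n) (h : ℕ → Action n) (r : ℕ) : ℝ :=
  ∑ q ∈ Finset.range (r + 1), (start G ω q + (h q).1)

/-- The time at which validator `k` receives the block of round `r`. -/
def receipt (G : Game n) (ω : ℕ → Move n) (h : ℕ → Action n) (k : Fin n) (r : ℕ) : ℝ :=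
  broadcast G ω h r + (ω r).2.1 (ω r).1 k

/-- The time at which the leader of round `r` becomes able to propose. -/
def ready (G : Game n) (ω : ℕ → Move n) (h : ℕ → Action n) (r : ℕ) : ℝ :=
  (∑ q ∈ Finset.range r, (start G ω q + (h q).1)) + start G ω r

/-! ### Information and strategies -/

/-- What a validator remembers of a past round: its leader; the time at which she received its block;
the published votes; and, if she led it, the time at which she became able to propose, the oracle's
answer `Δ*`, and her delay (`0, 0, 0` if she did not lead it). -/
abbrev Memory (n : ℕ) := Fin n × ℝ × (Fin n → ℝ) × (ℝ × ℝ × ℝ)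

/-- What the leader of round `r` knows when she chooses her delay: her memory of the earlier rounds,
the time at which she became able to propose, and the oracle's answer `Δ*`. -/
abbrev LeaderView (n r : ℕ) := (Fin r → Memory n) × ℝ × ℝ

/-- A strategy of a validator.  The vote in round `r` is a function of the times at which she received
the blocks of rounds `0, …, r`.  A delay has to lie in `[0, Δ*]` (only `0` is left if `Δ* < 0`). -/
structure Strategy (n : ℕ) where
  propose : (r : ℕ) → LeaderView n r → ℝ
  vote : (r : ℕ) → (Fin (r + 1) → ℝ) → ℝ
  propose_mem : ∀ r I, propose r I ∈ Set.Icc 0 (max 0 I.2.2)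
  measurable_propose : ∀ r, Measurable (propose r)
  measurable_vote : ∀ r, Measurable (vote r)

/-- A strategy profile. -/
abbrev Profile (n : ℕ) := Fin n → Strategy n

/-- The memory of `i` of the past round `q`. -/
def memory (G : Game n) (ω : ℕ → Move n) (h : ℕ → Action n) (i : Fin n) (q : ℕ) : Memory n :=
  ((ω q).1, receipt G ω h i q, (h q).2,
    if (ω q).1 = i then (ready G ω h q, cap G ω q, (h q).1) else (0, 0, 0))

/-- The information of the leader of round `r` after the actions `h 0, …, h (r - 1)`. -/
def leaderView (G : Game n) (ω : ℕ → Move n) (h : ℕ → Action n) (r : ℕ) : LeaderView n r :=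
  (fun q => memory G ω h (ω r).1 q, ready G ω h r, cap G ω r)

/-- The early-proposing truthful strategy: no delay, and the vote is the observed round duration, the
time between the receipt of the previous block (the start of the game, for the first round) and the
receipt of the current one. -/
def truthful (n : ℕ) : Strategy n where
  propose _ _ := 0
  vote
    | 0, t => t 0
    | r + 1, t => t (Fin.last (r + 1)) - t (Fin.last r).castSucc
  propose_mem _ _ := ⟨le_rfl, le_max_left _ _⟩
  measurable_propose _ := measurable_const
  measurable_vote r := by
    cases r with
    | zero => exact measurable_pi_apply _
    | succ r => exact (measurable_pi_apply _).sub (measurable_pi_apply _)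

/-- The profile `σ*` in which everybody proposes early and votes truthfully. -/
def truthfulProfile (n : ℕ) : Profile n := fun _ => truthful n

/-! ### Play

Decision nodes are ordered in time: number `2 * r` is the choice of the delay in round `r`, number
`2 * r + 1` is the vote in round `r`. -/

/-- The delay in round `r` prescribed by the profile `σ` after the actions `h 0, …, h (r - 1)`. -/
def delayOf (G : Game n) (σ : Profile n) (ω : ℕ → Move n) (h : ℕ → Action n) (r : ℕ) : ℝ :=
  (σ (ω r).1).propose r (leaderView G ω h r)

/-- The votes in round `r` prescribed by `σ`, given the delays up to round `r` listed in `h`.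
The leader does not vote (her entry is `0` and is never counted). -/
def votesOf (G : Game n) (σ : Profile n) (ω : ℕ → Move n) (h : ℕ → Action n) (r : ℕ) :
    Fin n → ℝ := fun k =>
  if k = (ω r).1 then 0 else (σ k).vote r fun q => receipt G ω h k q

/-- The record of actions after `r` rounds (its entries `0, …, r - 1`), when the actions at the nodes
before number `N` are those listed in `p`, whatever they are, and `σ` is played from node `N` on. -/
def record (G : Game n) (N : ℕ) (p : ℕ → Action n) (σ : Profile n) (ω : ℕ → Move n) :
    ℕ → ℕ → Action n
  | 0 => fun _ => 0
  | r + 1 =>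
    let h := record G N p σ ω r
    let δ := if 2 * r < N then (p r).1 else delayOf G σ ω h r
    let h' := Function.update h r (δ, 0)
    let v := if 2 * r + 1 < N then (p r).2 else votesOf G σ ω h' r
    Function.update h r (δ, v)

/-- The actions in round `r` when `p` describes the play before node `N` and `σ` is played from there
on. -/
def play (G : Game n) (N : ℕ) (p : ℕ → Action n) (σ : Profile n) (ω : ℕ → Move n) (r : ℕ) :
    Action n :=
  record G N p σ ω (r + 1) r

/-! ### Utilities -/

/-- The duration `Δ + s` of round `r`. -/
def duration (G : Game n) (ω : ℕ → Move n) (h : ℕ → Action n) (r : ℕ) : ℝ :=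
  (h r).1 + start G ω r

/-- The aggregated timeliness vote `v*` in round `r`: the `m`-th smallest vote of the validators other
than the leader. -/
def aggregatedVote (G : Game n) (ω : ℕ → Move n) (h : ℕ → Action n) (r : ℕ) : ℝ :=
  orderStat (Finset.univ.erase (ω r).1) (h r).2 G.m

/-- The reward `M (Δ + s) + B v*` of the leader of round `r`. -/
def leaderReward (G : Game n) (ω : ℕ → Move n) (h : ℕ → Action n) (r : ℕ) : ℝ :=
  G.M (duration G ω h r) + G.B (aggregatedVote G ω h r)

/-- The reward of `i` per unit of time over the first `R` rounds. -/
def averageReward (G : Game n) (i : Fin n) (ω : ℕ → Move n) (h : ℕ → Action n) (R : ℕ) : ℝ :=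
  (∑ r ∈ Finset.range R, if (ω r).1 = i then leaderReward G ω h r else 0) /
    ∑ r ∈ Finset.range R, duration G ω h r

/-- The long-run time-averaged reward of `i` along a play.  The upper limit makes it meaningful for
profiles for which the averages do not converge. -/
def longRun (G : Game n) (i : Fin n) (ω : ℕ → Move n) (h : ℕ → Action n) : ℝ :=
  limsup (averageReward G i ω h) atTop

/-- The utility of `i` under the profile `σ`. -/
def utility [NeZero n] (G : Game n) (σ : Profile n) (i : Fin n) : ℝ :=
  ∫ ω, longRun G i ω (play G 0 0 σ ω) ∂G.pathLaw

/-- Nature's moves: those of `ω₀` in rounds `0, …, r`, and those of `ω` in later rounds. -/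
def splice (r : ℕ) (ω₀ ω : ℕ → Move n) : ℕ → Move n := fun q => if q ≤ r then ω₀ q else ω q

/-- The expected utility of `i` in the continuation from node `N` (in round `N / 2`), if `σ` is played
from there on.  Here `β` is the belief of `i` about everything that is already determined: the
actions at the earlier nodes and nature's moves up to and including round `N / 2`.  Nature's later
moves are independent of it and follow their law. -/
def continuationUtility [NeZero n] (G : Game n) (N : ℕ)
    (β : Measure ((ℕ → Action n) × (ℕ → Move n))) (σ : Profile n) (i : Fin n) : ℝ :=
  ∫ z, longRun G i (splice (N / 2) z.1.2 z.2)
    (play G N z.1.1 σ (splice (N / 2) z.1.2 z.2)) ∂(β.prod G.pathLaw)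

/-- Subgame-perfect Bayes-Nash equilibrium: at every decision node, on or off the path of play, no
validator can raise her expected utility by replacing her strategy, the others continuing with `σ`.
This is required for every belief about the past: those concentrated on a single history, the
prior, and the posterior given any information (such as the oracle's answer) are all among them. -/
def IsSubgamePerfectBayesNash [NeZero n] (G : Game n) (σ : Profile n) : Prop :=
  ∀ (N : ℕ) (β : Measure ((ℕ → Action n) × (ℕ → Move n))), IsProbabilityMeasure β →
    ∀ (i : Fin n) (s : Strategy n),
      continuationUtility G N β (Function.update σ i s) i ≤ continuationUtility G N β σ i

end Timing

end

/-! Plays are compared path by path and round by round with the play without delay. Start times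
depend on nature's moves only, so a delay `δ` lengthens its own round by `δ` and leaves later start
times alone. With truthful voters it also adds `δ` to every counted vote, hence to the aggregated
vote (`aggregatedVote_play_succ`). Since `m > n - c`, some voter lies both in a fastest quorum and
among the `m` smallest latency gaps, which makes the undelayed aggregated vote nonnegative
(`startTime_add_voteError_nonneg`). So `B` is evaluated where it is linear and loses exactly `b *
δ`, while `M` gains at most `b * δ` because `M + B` decreases (`M_add_le`). The deviator's own vote
does not count in the rounds that the deviator leads. A deviation thus yields rewards no larger and
durations no smaller than the reference; the reference rewards being nonnegative almost surely, the
ratio of sums cannot rise (`limsup_ratio_le`).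

The reference rewards and durations are functions of two consecutive i.i.d. moves, so their averages
converge almost surely (`ae_tendsto_average_consecutive`). The finitely many rounds touched by the
past disappear from the averages. Truthful continuation therefore has the same constant value at
every node and for every belief, and a deviation stays below it on almost every path. -/

noncomputable section

namespace Timing

/-! ### Order statistics -/

section OrderStat

variable {ι : Type*} {s : Finset ι} {f g : ι → ℝ} {x : ℕ}

/-- The set whose infimum is the order statistic is a closed half-line starting at a value. -/
theorem exists_setOf_le_card_eq_Ici (h1 : 1 ≤ x) (hx : x ≤ s.card) :
    ∃ k ∈ s, {t : ℝ | x ≤ (s.filter fun k => f k ≤ t).card} = Set.Ici (f k) := by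
  classical
  set A : Set ℝ := {t : ℝ | x ≤ (s.filter fun k => f k ≤ t).card} with hA
  have hup : ∀ t ∈ A, ∀ u, t ≤ u → u ∈ A := fun t ht u htu =>
    le_trans (show x ≤ _ from ht)
      (Finset.card_le_card (Finset.monotone_filter_right s fun k _ hk => le_trans hk htu))
  have hval : ∀ t ∈ A, ∃ k ∈ s, f k ≤ t ∧ f k ∈ A := by
    intro t ht
    have ht' : x ≤ (s.filter fun k => f k ≤ t).card := ht
    obtain ⟨k, hk, hmax⟩ := Finset.exists_max_image (s.filter fun k => f k ≤ t) f
      (Finset.card_pos.1 (by omega))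
    rw [Finset.mem_filter] at hk
    refine ⟨k, hk.1, hk.2, le_trans ht' (Finset.card_le_card fun j hj => ?_)⟩
    exact Finset.mem_filter.2 ⟨(Finset.mem_filter.1 hj).1, hmax j hj⟩
  have hs : s.Nonempty := Finset.card_pos.1 (by omega)
  obtain ⟨k₁, -, hk₁⟩ := Finset.exists_max_image s f hs
  have hmem : f k₁ ∈ A := by
    have : (s.filter fun k => f k ≤ f k₁) = s := Finset.filter_true_of_mem hk₁
    simpa [hA, this] using hx
  obtain ⟨k₂, hk₂, -, hk₂A⟩ := hval _ hmem
  obtain ⟨k, hk, hmin⟩ := Finset.exists_min_image (s.filter fun k => f k ∈ A) f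
    ⟨k₂, Finset.mem_filter.2 ⟨hk₂, hk₂A⟩⟩
  rw [Finset.mem_filter] at hk
  refine ⟨k, hk.1, Set.ext fun t => ⟨fun ht => ?_, fun ht => hup _ hk.2 t ht⟩⟩
  obtain ⟨j, hj, hjt, hjA⟩ := hval t ht
  exact (hmin j (Finset.mem_filter.2 ⟨hj, hjA⟩)).trans hjt

/-- Turns questions about order statistics into counting. The rank bounds exclude the cases where
the set is empty or all of `ℝ` and `sInf` is the default `0`. -/
theorem orderStat_le_iff (h1 : 1 ≤ x) (hx : x ≤ s.card) {t : ℝ} :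
    orderStat s f x ≤ t ↔ x ≤ (s.filter fun k => f k ≤ t).card := by
  obtain ⟨k, -, hk⟩ := exists_setOf_le_card_eq_Ici (f := f) h1 hx
  have : orderStat s f x = f k := by rw [orderStat, hk, csInf_Ici]
  rw [this, ← Set.mem_Ici, ← hk, Set.mem_ofPred_eq]

theorem le_card_filter_le_orderStat (h1 : 1 ≤ x) (hx : x ≤ s.card) :
    x ≤ (s.filter fun k => f k ≤ orderStat s f x).card :=
  (orderStat_le_iff h1 hx).1 le_rfl

theorem orderStat_congr (h : ∀ k ∈ s, f k = g k) : orderStat s f x = orderStat s g x := by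
  have : ∀ t : ℝ, (s.filter fun k => f k ≤ t) = s.filter fun k => g k ≤ t := fun t =>
    Finset.filter_congr fun k hk => by rw [h k hk]
  simp only [orderStat, this]

/-- This is how a delay common to all observed durations passes to the aggregated vote. -/
theorem orderStat_const_add (h1 : 1 ≤ x) (hx : x ≤ s.card) (a : ℝ) :
    orderStat s (fun k => a + f k) x = a + orderStat s f x := by
  refine eq_of_forall_ge_iff fun t => ?_
  rw [orderStat_le_iff h1 hx, ← le_sub_iff_add_le', orderStat_le_iff h1 hx]
  simp only [le_sub_iff_add_le']

theorem measurable_orderStat {α : Type*} [MeasurableSpace α] {F : ι → α → ℝ}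
    (hF : ∀ k, Measurable (F k)) (h1 : 1 ≤ x) (hx : x ≤ s.card) :
    Measurable fun a => orderStat s (fun k => F k a) x := by
  refine measurable_of_Iic fun t => ?_
  have : (fun a => orderStat s (fun k => F k a) x) ⁻¹' Set.Iic t =
      {a | x ≤ ∑ k ∈ s, if F k a ≤ t then 1 else 0} := by
    ext a
    rw [Set.mem_preimage, Set.mem_Iic, orderStat_le_iff h1 hx, Finset.card_filter,
      Set.mem_ofPred_eq]
  rw [this]
  refine measurableSet_le measurable_const (Finset.measurable_fun_sum _ fun k _ => ?_)
  exact Measurable.ite (measurableSet_le (hF k) measurable_const) measurable_const measurable_const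

end OrderStat

/-! ### Start times and vote errors -/

variable {n : ℕ}

theorem startTime_nonneg (c : ℕ) (d : Draw n) (j i : Fin n) : 0 ≤ startTime c d j i :=
  le_max_of_le_right (d.1 j i).2

theorem measurable_startTime {c : ℕ} (hc1 : 1 ≤ c) (hcn : c ≤ n) (j i : Fin n) :
    Measurable fun d : Draw n => startTime c d j i := by
  unfold startTime quorumTime
  refine (measurable_orderStat (fun k => ?_) hc1 (by simpa using hcn)).max ?_ <;> fun_prop

theorem measurable_voteError {m : ℕ} (hm1 : 1 ≤ m) (hmn : m ≤ n - 1) (j i : Fin n) :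
    Measurable fun d : Draw n × Draw n => voteError m d.1 d.2 j i := by
  unfold voteError latencyGap
  refine measurable_orderStat (fun k => ?_) hm1 (by simpa using hmn)
  fun_prop

/-- Some voter is among the quorum and among the `m` earliest, so that her observed round duration
bounds the start time plus the vote error from below. -/
theorem startTime_add_voteError_nonneg {c m : ℕ} (hc1 : 1 ≤ c) (hcn : c ≤ n) (hmn : m ≤ n - 1)
    (hm : n - c < m) (d d' : Draw n) (j i : Fin n) :
    0 ≤ startTime c d j i + voteError m d d' j i := by
  classical
  have h1 : c ≤ _ := le_card_filter_le_orderStat (s := Finset.univ)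
    (f := fun k => (d.1 j k : ℝ) + d.2 k i) hc1 (by simpa using hcn)
  have h2 : m ≤ _ := le_card_filter_le_orderStat (s := Finset.univ.erase i)
    (f := latencyGap d d' j i) (by omega) (by simpa using hmn)
  -- Pigeonhole: sets of at least `c` and at least `m` validators meet, since `c + m > n`.
  obtain ⟨k, hk⟩ : ((Finset.univ.filter fun k =>
      (d.1 j k : ℝ) + d.2 k i ≤ quorumTime c d j i) ∩
      ((Finset.univ.erase i).filter fun k => latencyGap d d' j i k ≤ voteError m d d' j i)).Nonempty
      := by
    by_contra hne
    rw [Finset.not_nonempty_iff_eq_empty, ← Finset.disjoint_iff_inter_eq_empty] at hne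
    have := (Finset.card_union_of_disjoint hne).symm.trans_le (Finset.card_le_univ _)
    rw [Fintype.card_fin] at this
    unfold quorumTime voteError at this
    omega
  have hk1 : (d.1 j k : ℝ) + d.2 k i ≤ quorumTime c d j i :=
    (Finset.mem_filter.1 (Finset.mem_inter.1 hk).1).2
  have hk2 : (d'.1 i k : ℝ) - d.1 j k ≤ voteError m d d' j i :=
    (Finset.mem_filter.1 (Finset.mem_inter.1 hk).2).2
  have hs : quorumTime c d j i ≤ startTime c d j i := le_max_left _ _
  have := (d.2 k i).coe_nonneg
  have := (d'.1 i k).coe_nonneg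
  linarith

/-! ### Actions along a play -/

section Play

variable (G : Game n) (N : ℕ) (p : ℕ → Action n) (σ : Profile n) (ω : ℕ → Move n)

/-- Each round rewrites only its own entry, so an entry is final once its round is over. -/
theorem record_eq_play {r R : ℕ} (h : r < R) : record G N p σ ω R r = play G N p σ ω r := by
  induction R, h using Nat.le_induction with
  | base => rfl
  | succ R hR ih =>
    rw [← ih, record]
    exact Function.update_of_ne (by omega) _ _

variable {G N p σ ω}

theorem play_fst {r : ℕ} (hr : N ≤ 2 * r) :
    (play G N p σ ω r).1 = delayOf G σ ω (record G N p σ ω r) r := by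
  simp [play, record, Nat.not_lt.2 hr]

/-- Receipt times depend on delays, not on votes, so the provisional zero votes and the later
entries of the play do not matter. The vote is node `2 * r + 1`; the delay of the same round may
still belong to `p`. -/
theorem play_snd {r : ℕ} (hr : N ≤ 2 * r + 1) :
    (play G N p σ ω r).2 = votesOf G σ ω (play G N p σ ω) r := by
  have h : ∀ q ≤ r, (Function.update (record G N p σ ω r) r
      (((play G N p σ ω r).1, 0) : Action n) q).1 = (play G N p σ ω q).1 := by
    intro q hq
    rcases hq.eq_or_lt with rfl | hq
    · simp
    · rw [Function.update_of_ne hq.ne, record_eq_play G N p σ ω hq]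
  have h' : (play G N p σ ω r).2 = votesOf G σ ω (Function.update (record G N p σ ω r) r
      (((play G N p σ ω r).1, 0) : Action n)) r := by
    conv_lhs => rw [play, record]
    simp only [Nat.not_lt.2 hr, if_false, Function.update_self]
    simp [play, record]
  rw [h']
  funext k
  unfold votesOf
  split_ifs with hk
  · rfl
  · congr 1
    funext q
    unfold receipt broadcast
    congr 1
    refine Finset.sum_congr rfl fun u hu => ?_
    rw [h u (by have := Finset.mem_range.1 hu; omega)]

theorem play_truthful_fst {r : ℕ} (hr : N ≤ 2 * r) :
    (play G N p (truthfulProfile n) ω r).1 = 0 := play_fst hr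

theorem play_fst_nonneg {r : ℕ} (hr : N ≤ 2 * r) : 0 ≤ (play G N p σ ω r).1 := by
  rw [play_fst hr]
  exact ((σ _).propose_mem _ _).1

theorem receipt_succ_sub (h : ℕ → Action n) (k : Fin n) (r : ℕ) :
    receipt G ω h k (r + 1) - receipt G ω h k r =
      duration G ω h (r + 1) + latencyGap (ω r).2 (ω (r + 1)).2 (ω r).1 (ω (r + 1)).1 k := by
  simp only [receipt, broadcast, Finset.sum_range_succ _ (r + 1), duration, latencyGap]
  ring

/-- If all voters are truthful, the aggregated vote is the round duration plus the vote error. -/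
theorem aggregatedVote_play_succ {r : ℕ} (hr : N ≤ 2 * r + 3) (hm1 : 1 ≤ G.m) (hmn : G.m ≤ n - 1)
    (hσ : ∀ k ≠ (ω (r + 1)).1, σ k = truthful n) :
    aggregatedVote G ω (play G N p σ ω) (r + 1) = duration G ω (play G N p σ ω) (r + 1) +
      voteError G.m (ω r).2 (ω (r + 1)).2 (ω r).1 (ω (r + 1)).1 := by
  rw [aggregatedVote, voteError, ← orderStat_const_add hm1 (by simpa using hmn)]
  -- Only validators other than the leader are counted, so the leader need not be truthful.
  refine orderStat_congr fun k hk => ?_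
  have hk : k ≠ (ω (r + 1)).1 := by simpa using hk
  rw [play_snd (by omega), votesOf, if_neg hk, hσ k hk, ← receipt_succ_sub]
  rfl

end Play

/-! ### Averages of functions of consecutive moves -/

section Average

theorem tendsto_add_one_div_two_div_atTop :
    Tendsto (fun R : ℕ => (((R + 1) / 2 : ℕ) : ℝ) / R) atTop (𝓝 (1 / 2)) := by
  have h : Tendsto (fun R : ℕ => (1 / 2 : ℝ) + 1 / (R : ℝ)) atTop (𝓝 (1 / 2 + 0)) :=
    tendsto_const_nhds.add tendsto_one_div_atTop_nhds_zero_nat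
  rw [add_zero] at h
  refine tendsto_of_tendsto_of_tendsto_of_le_of_le' tendsto_const_nhds h ?_ ?_ <;>
    filter_upwards [eventually_gt_atTop 0] with R hR <;>
    have hR' : (0 : ℝ) < R := by exact_mod_cast hR
  · rw [le_div_iff₀ hR']
    have : (R : ℝ) ≤ 2 * ((R + 1) / 2 : ℕ) := by exact_mod_cast (by omega)
    linarith
  · rw [div_le_iff₀ hR', add_mul, one_div_mul_cancel hR'.ne']
    have : 2 * (((R + 1) / 2 : ℕ) : ℝ) ≤ R + 1 := by exact_mod_cast (by omega)
    linarith

theorem tendsto_div_two_div_atTop :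
    Tendsto (fun R : ℕ => ((R / 2 : ℕ) : ℝ) / R) atTop (𝓝 (1 / 2)) := by
  have h : Tendsto (fun R : ℕ => 1 - (((R + 1) / 2 : ℕ) : ℝ) / R) atTop (𝓝 (1 - 1 / 2)) :=
    tendsto_const_nhds.sub tendsto_add_one_div_two_div_atTop
  norm_num at h
  refine Tendsto.congr' ?_ (by simpa using h)
  filter_upwards [eventually_gt_atTop 0] with R hR
  have hR' : (0 : ℝ) < R := by exact_mod_cast hR
  have : (R : ℝ) = ((R / 2 : ℕ) : ℝ) + ((R + 1) / 2 : ℕ) := by exact_mod_cast (by omega)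
  field_simp
  linarith

theorem sum_range_eq_even_add_odd (x : ℕ → ℝ) (R : ℕ) :
    ∑ r ∈ Finset.range R, x r = ∑ k ∈ Finset.range ((R + 1) / 2), x (2 * k + 0) +
      ∑ k ∈ Finset.range (R / 2), x (2 * k + 1) := by
  induction R with
  | zero => simp
  | succ R ih =>
    rw [Finset.sum_range_succ, ih]
    rcases Nat.even_or_odd' R with ⟨k, rfl | rfl⟩
    · rw [show (2 * k + 1 + 1) / 2 = k + 1 by omega, show (2 * k + 1) / 2 = k by omega,
        show 2 * k / 2 = k by omega, Finset.sum_range_succ, add_zero]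
      ring
    · rw [show (2 * k + 1 + 1 + 1) / 2 = k + 1 by omega, show (2 * k + 1 + 1) / 2 = k + 1 by omega,
        show (2 * k + 1) / 2 = k by omega, Finset.sum_range_succ (fun k => x (2 * k + 1))]
      ring

/-- The overall average is a combination of the two averages with weights tending to `1 / 2`. -/
theorem tendsto_average_of_even_odd {x : ℕ → ℝ} {a : ℝ}
    (h0 : Tendsto (fun K : ℕ => (∑ k ∈ Finset.range K, x (2 * k + 0)) / K) atTop (𝓝 a))
    (h1 : Tendsto (fun K : ℕ => (∑ k ∈ Finset.range K, x (2 * k + 1)) / K) atTop (𝓝 a)) :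
    Tendsto (fun R : ℕ => (∑ r ∈ Finset.range R, x r) / R) atTop (𝓝 a) := by
  have key : ∀ (y : ℕ → ℝ) (m R : ℕ),
      (∑ k ∈ Finset.range m, y k) / m * (m / R : ℝ) = (∑ k ∈ Finset.range m, y k) / R := by
    intro y m R
    rcases Nat.eq_zero_or_pos m with rfl | hm
    · simp
    · have : (m : ℝ) ≠ 0 := by positivity
      field_simp
  have hdiv : Tendsto (fun R : ℕ => R / 2) atTop atTop := Nat.tendsto_div_const_atTop two_ne_zero
  have := ((h0.comp (hdiv.comp (tendsto_add_atTop_nat 1))).mul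
    tendsto_add_one_div_two_div_atTop).add ((h1.comp hdiv).mul tendsto_div_two_div_atTop)
  rw [← mul_add, show (1 / 2 + 1 / 2 : ℝ) = 1 by norm_num, mul_one] at this
  refine this.congr fun R => ?_
  simp only [Function.comp_apply, key]
  rw [sum_range_eq_even_add_odd x R, add_div]

/-- Changing finitely many terms and shifting the index do not change the limiting average. -/
theorem tendsto_average_of_eventually_succ_eq {x y : ℕ → ℝ} {a : ℝ} {K : ℕ}
    (hx : Tendsto (fun R : ℕ => (∑ r ∈ Finset.range R, x r) / R) atTop (𝓝 a))
    (hy : ∀ q, K ≤ q → y (q + 1) = x q) :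
    Tendsto (fun R : ℕ => (∑ r ∈ Finset.range R, y r) / R) atTop (𝓝 a) := by
  rw [← tendsto_add_atTop_iff_nat 1]
  -- Past `K` the two partial sums differ by this constant, which vanishes after division by `R +
  -- 1`.
  set C : ℝ := ∑ r ∈ Finset.range (K + 1), y r - ∑ r ∈ Finset.range K, x r
  have hC : Tendsto (fun R : ℕ => C / ((R + 1 : ℕ) : ℝ)) atTop (𝓝 0) :=
    tendsto_const_nhds.div_atTop (tendsto_natCast_atTop_atTop.comp (tendsto_add_atTop_nat 1))
  have := (hx.mul (tendsto_natCast_div_add_atTop (𝕜 := ℝ) 1)).add hC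
  rw [mul_one, add_zero] at this
  refine Tendsto.congr' ?_ this
  filter_upwards [eventually_ge_atTop K, eventually_gt_atTop 0] with R hR hR0
  have hsum : ∑ r ∈ Finset.range (R + 1), y r = ∑ r ∈ Finset.range R, x r + C := by
    clear hR0
    induction R, hR using Nat.le_induction with
    | base => simp [C]
    | succ R hR ih =>
      rw [Finset.sum_range_succ, Finset.sum_range_succ x, hy R hR, ih]
      ring
  have : (R : ℝ) ≠ 0 := by positivity
  rw [hsum]
  push_cast
  field_simp

open ProbabilityTheory in
/-- Strong law of large numbers for a function of consecutive terms of an i.i.d. sequence. -/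
theorem ae_tendsto_average_consecutive {α : Type*} [MeasurableSpace α] (μ : Measure α)
    [IsProbabilityMeasure μ] {F : α × α → ℝ} (hF : Measurable F) (hint : Integrable F (μ.prod μ)) :
    ∀ᵐ ω ∂Measure.infinitePi fun _ : ℕ => μ,
      Tendsto (fun R : ℕ => (∑ r ∈ Finset.range R, F (ω r, ω (r + 1))) / R) atTop
        (𝓝 (∫ z, F z ∂μ.prod μ)) := by
  set P := Measure.infinitePi fun _ : ℕ => μ
  have hpair : ∀ r, P.map (fun ω => (ω r, ω (r + 1))) = μ.prod μ := fun r =>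
    Measure.infinitePi_map_eval_prod (P := fun _ => μ) (Nat.succ_ne_self r).symm
  have hmp : ∀ r, MeasurePreserving (fun ω : ℕ → α => (ω r, ω (r + 1))) P (μ.prod μ) := fun r =>
    ⟨by fun_prop, hpair r⟩
  have hind : iIndepFun (fun (r : ℕ) (ω : ℕ → α) => ω r) P :=
    iIndepFun_infinitePi (P := fun _ => μ) (X := fun _ ω => ω) fun _ => measurable_id
  -- Consecutive pairs overlap, but the pairs starting at indices of one parity are disjoint, hence
  -- independent.
  have half : ∀ e, ∀ᵐ ω ∂P, Tendsto (fun K : ℕ =>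
      (∑ k ∈ Finset.range K, F (ω (2 * k + e), ω (2 * k + e + 1))) / K) atTop
        (𝓝 (∫ z, F z ∂μ.prod μ)) := by
    intro e
    have hE : ∫ ω, F (ω (2 * 0 + e), ω (2 * 0 + e + 1)) ∂P = ∫ z, F z ∂μ.prod μ := by
      rw [← hpair (2 * 0 + e), integral_map (by fun_prop) hF.aestronglyMeasurable]
    rw [← hE]
    refine strong_law_ae_real (μ := P)
      (fun k ω => F (ω (2 * k + e), ω (2 * k + e + 1))) ?_ ?_ ?_
    · exact (hmp _).integrable_comp_of_integrable hint
    · intro k l hkl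
      exact (hind.indepFun_prodMk_prodMk (fun _ => measurable_pi_apply _) (2 * k + e)
        (2 * k + e + 1) (2 * l + e) (2 * l + e + 1) (by omega) (by omega) (by omega)
        (by omega)).comp hF hF
    · intro k
      have : IdentDistrib (fun ω : ℕ → α => (ω (2 * k + e), ω (2 * k + e + 1)))
          (fun ω : ℕ → α => (ω (2 * 0 + e), ω (2 * 0 + e + 1))) P P :=
        ⟨(hmp _).aemeasurable, (hmp _).aemeasurable, by rw [hpair, hpair]⟩
      exact this.comp hF
  filter_upwards [half 0, half 1] with ω h0 h1
  exact tendsto_average_of_even_odd (x := fun r => F (ω r, ω (r + 1))) h0 h1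

/-- A ratio of sums with smaller terms above and larger terms below has a smaller upper limit. -/
theorem limsup_ratio_le {t x d y : ℕ → ℝ} {a b : ℝ} (hx0 : ∀ r, 0 ≤ x r) (htx : ∀ r, t r ≤ x r)
    (hyd : ∀ r, y r ≤ d r) (hb : 0 < b)
    (hx : Tendsto (fun R : ℕ => (∑ r ∈ Finset.range R, x r) / R) atTop (𝓝 a))
    (hy : Tendsto (fun R : ℕ => (∑ r ∈ Finset.range R, y r) / R) atTop (𝓝 b)) :
    limsup (fun R : ℕ => (∑ r ∈ Finset.range R, t r) / ∑ r ∈ Finset.range R, d r) atTop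
      ≤ a / b := by
  have ha : 0 ≤ a := ge_of_tendsto' hx fun R =>
    div_nonneg (Finset.sum_nonneg fun r _ => hx0 r) (Nat.cast_nonneg R)
  have hlim := hx.div hy hb.ne'
  have hle : ∀ᶠ R : ℕ in atTop, (∑ r ∈ Finset.range R, t r) / ∑ r ∈ Finset.range R, d r ≤
      (∑ r ∈ Finset.range R, x r) / R / ((∑ r ∈ Finset.range R, y r) / R) := by
    -- Since `b > 0`, the smaller denominator is eventually positive; the numerators `t` may be
    -- negative.
    filter_upwards [hy.eventually_const_lt hb, eventually_gt_atTop 0] with R hR hR0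
    have hR' : (0 : ℝ) < R := by exact_mod_cast hR0
    have hY : 0 < ∑ r ∈ Finset.range R, y r := by
      have := mul_pos hR hR'
      rwa [div_mul_cancel₀ _ hR'.ne'] at this
    rw [div_div_div_cancel_right₀ hR'.ne']
    exact div_le_div₀ (Finset.sum_nonneg fun r _ => hx0 r) (Finset.sum_le_sum fun r _ => htx r) hY
      (Finset.sum_le_sum fun r _ => hyd r)
  rw [limsup_eq]
  set A : Set ℝ := {u | ∀ᶠ R : ℕ in atTop,
    (∑ r ∈ Finset.range R, t r) / ∑ r ∈ Finset.range R, d r ≤ u}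
  by_cases hA : BddBelow A
  · refine le_of_forall_pos_le_add fun ε hε => csInf_le hA ?_
    filter_upwards [hle, hlim.eventually_lt_const (lt_add_of_pos_right _ hε)] with R h1 h2
    exact h1.trans h2.le
  -- If the ratios tend to `-∞`, the real `limsup` is the default `0`, still at most `a / b`.
  · rw [Real.sInf_of_not_bddBelow hA]
    exact div_nonneg ha hb.le

end Average

/-! ### Integrals over consecutive moves -/

section Moves

variable [NeZero n] (G : Game n)

instance [IsProbabilityMeasure G.lat] : IsProbabilityMeasure G.moveLaw := by
  unfold Game.moveLaw; infer_instance

instance [IsProbabilityMeasure G.lat] : IsProbabilityMeasure G.pathLaw := by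
  unfold Game.pathLaw; infer_instance

/-- Conditioning on the two uniform, independent leaders leaves only the latency laws to integrate.
-/
theorem moveLaw_prod_moveLaw [IsProbabilityMeasure G.lat] :
    G.moveLaw.prod G.moveLaw = ((n : ENNReal)⁻¹ * (n : ENNReal)⁻¹) •
      ∑ j, ∑ k, (G.lat.prod G.lat).map fun d => ((j, d.1), (k, d.2)) := by
  have hlaw : ∀ s : Set (Move n), MeasurableSet s → G.moveLaw s =
      (n : ENNReal)⁻¹ * ∑ j, G.lat (Prod.mk j ⁻¹' s) := by
    intro s hs
    rw [Game.moveLaw, Measure.prod_apply hs, lintegral_fintype, Finset.mul_sum]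
    refine Finset.sum_congr rfl fun j _ => ?_
    rw [PMF.toMeasure_apply_singleton _ _ (measurableSet_singleton j),
      PMF.uniformOfFintype_apply, Fintype.card_fin, mul_comm]
  refine (Measure.prod_eq fun s t hs ht => ?_)
  rw [hlaw s hs, hlaw t ht, Measure.smul_apply, Measure.finsetSum_apply, smul_eq_mul,
    mul_mul_mul_comm, Finset.sum_mul_sum]
  congr 1
  refine Finset.sum_congr rfl fun j _ => ?_
  rw [Measure.finsetSum_apply]
  refine Finset.sum_congr rfl fun k _ => ?_
  rw [Measure.map_apply (by fun_prop) (hs.prod ht), ← Measure.prod_prod]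
  rfl

theorem integrable_and_integral_moveLaw_prod [IsProbabilityMeasure G.lat]
    {F : Move n × Move n → ℝ} (hF : Measurable F)
    (hint : ∀ j k, Integrable (fun d : Draw n × Draw n => F ((j, d.1), (k, d.2)))
      (G.lat.prod G.lat)) :
    Integrable F (G.moveLaw.prod G.moveLaw) ∧ ∫ z, F z ∂G.moveLaw.prod G.moveLaw =
      ((n : ℝ)⁻¹ * (n : ℝ)⁻¹) * ∑ j, ∑ k, ∫ d, F ((j, d.1), (k, d.2)) ∂G.lat.prod G.lat := by
  have hi : ∀ j k, Integrable F ((G.lat.prod G.lat).map fun d => ((j, d.1), (k, d.2))) :=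
    fun j k => (integrable_map_measure hF.aestronglyMeasurable (by fun_prop)).2 (hint j k)
  have hn : ((n : ENNReal)⁻¹ * (n : ENNReal)⁻¹) ≠ ⊤ := by
    have : (n : ENNReal) ≠ 0 := by exact_mod_cast NeZero.ne n
    exact ENNReal.mul_ne_top (ENNReal.inv_ne_top.2 this) (ENNReal.inv_ne_top.2 this)
  have hi' : ∀ j, Integrable F
      (∑ k, (G.lat.prod G.lat).map fun d => ((j, d.1), (k, d.2))) :=
    fun j => integrable_finsetSum_measure.2 fun k _ => hi j k
  rw [moveLaw_prod_moveLaw]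
  refine ⟨(integrable_finsetSum_measure.2 fun j _ => hi' j).smul_measure hn, ?_⟩
  rw [integral_smul_measure, integral_finsetSum_measure fun j _ => hi' j]
  simp only [ENNReal.toReal_mul, ENNReal.toReal_inv, ENNReal.toReal_natCast, smul_eq_mul]
  congr 1
  refine Finset.sum_congr rfl fun j _ => ?_
  rw [integral_finsetSum_measure fun k _ => hi j k]
  refine Finset.sum_congr rfl fun k _ => ?_
  rw [integral_map (by fun_prop) hF.aestronglyMeasurable]

/-- An almost sure property of the latencies of two rounds holds along almost every path, for all
consecutive rounds. -/
theorem ae_pathLaw_consecutive [IsProbabilityMeasure G.lat] {q : Draw n × Draw n → Prop}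
    (h : ∀ᵐ d ∂G.lat.prod G.lat, q d) :
    ∀ᵐ ω ∂G.pathLaw, ∀ r, q ((ω r).2, (ω (r + 1)).2) := by
  rw [ae_all_iff]
  intro r
  have h1 : MeasurePreserving (fun ω : ℕ → Move n => (ω r, ω (r + 1))) G.pathLaw
      (G.moveLaw.prod G.moveLaw) :=
    ⟨by fun_prop, Measure.infinitePi_map_eval_prod (P := fun _ => G.moveLaw)
      (Nat.succ_ne_self r).symm⟩
  have h2 : MeasurePreserving (Prod.snd : Move n → Draw n) G.moveLaw G.lat :=
    measurePreserving_snd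
  exact ((h2.prod h2).comp h1).quasiMeasurePreserving.ae h

end Moves

/-! ### Reference processes -/

section Reference

variable (G : Game n)

/-- The duration of a round led by `k` without delay, after a round led by `j`. -/
def promptDuration (j k : Fin n) (d : Draw n × Draw n) : ℝ := startTime G.c d.1 j k

/-- The reward of `i` in a round led by `k` without delay and with truthful votes, after a round led
by `j`. -/
def promptReward (i j k : Fin n) (d : Draw n × Draw n) : ℝ :=
  if k = i then
    G.M (startTime G.c d.1 j k) + G.B (startTime G.c d.1 j k + voteError G.m d.1 d.2 j k)
  else 0

/-- Evaluation of a function of two consecutive leaders and the latencies of their rounds. -/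
def alongMoves (f : Fin n → Fin n → Draw n × Draw n → ℝ) (z : Move n × Move n) : ℝ :=
  f z.1.1 z.2.1 (z.1.2, z.2.2)

theorem measurable_alongMoves {f : Fin n → Fin n → Draw n × Draw n → ℝ}
    (hf : ∀ j k, Measurable (f j k)) : Measurable (alongMoves f) := by
  -- There are finitely many pairs of leaders, so measurability for each pair suffices.
  have h : Measurable fun y : (Fin n × Fin n) × (Draw n × Draw n) => f y.1.1 y.1.2 y.2 :=
    measurable_from_prod_countable_right fun jk => hf jk.1 jk.2
  exact h.comp (g := fun y : (Fin n × Fin n) × (Draw n × Draw n) => f y.1.1 y.1.2 y.2)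
    (f := fun z : Move n × Move n => ((z.1.1, z.2.1), (z.1.2, z.2.2))) (by fun_prop)

theorem ae_tendsto_average_alongMoves [NeZero n] [IsProbabilityMeasure G.lat]
    {f : Fin n → Fin n → Draw n × Draw n → ℝ} (hf : ∀ j k, Measurable (f j k))
    (hint : ∀ j k, Integrable (f j k) (G.lat.prod G.lat)) :
    ∀ᵐ ω ∂G.pathLaw, Tendsto
      (fun R : ℕ => (∑ r ∈ Finset.range R, alongMoves f (ω r, ω (r + 1))) / R) atTop
      (𝓝 (((n : ℝ)⁻¹ * (n : ℝ)⁻¹) * ∑ j, ∑ k, ∫ d, f j k d ∂G.lat.prod G.lat)) := by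
  obtain ⟨h1, h2⟩ := integrable_and_integral_moveLaw_prod G (measurable_alongMoves hf) hint
  have := ae_tendsto_average_consecutive G.moveLaw (measurable_alongMoves hf) h1
  rw [h2] at this
  exact this

variable {G}

theorem measurable_M_startTime (hc1 : 1 ≤ G.c) (hcn : G.c ≤ n)
    (hM : MonotoneOn G.M (Set.Ici 0)) (j i : Fin n) :
    Measurable fun d : Draw n => G.M (startTime G.c d j i) := by
  -- `M` is monotone only on `[0, ∞)`; freezing it at `M 0` below gives a monotone function on `ℝ`.
  have h : Monotone fun x => G.M (max x 0) := fun x y hxy =>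
    hM (Set.mem_Ici.2 (le_max_right _ _)) (Set.mem_Ici.2 (le_max_right _ _)) (max_le_max_right 0 hxy)
  have := h.measurable.comp (measurable_startTime hc1 hcn j i)
  simpa only [Function.comp_def, max_eq_left (startTime_nonneg G.c _ j i)] using this

variable {b : ℝ}

/-- As `B` has slope `-b`, `M` can grow with slope at most `b`. This bounds the gain from a delay
and also makes `M` of the start time integrable. -/
theorem M_add_le (hB : ∀ x, 0 ≤ x → G.B x = b * G.τ - b * x)
    (hdec : AntitoneOn (fun x => G.M x + G.B x) (Set.Ici 0)) {x δ : ℝ} (hx : 0 ≤ x) (hδ : 0 ≤ δ) :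
    G.M (δ + x) ≤ G.M x + b * δ := by
  have := hdec (show x ∈ Set.Ici 0 from hx) (show δ + x ∈ Set.Ici 0 from add_nonneg hδ hx)
    (le_add_of_nonneg_left hδ)
  simp only [hB x hx, hB _ (add_nonneg hδ hx)] at this
  linarith

theorem integrable_M_startTime [IsProbabilityMeasure G.lat] (hc1 : 1 ≤ G.c) (hcn : G.c ≤ n)
    (hM0 : ∀ x, 0 ≤ x → 0 ≤ G.M x) (hM : MonotoneOn G.M (Set.Ici 0))
    (hB : ∀ x, 0 ≤ x → G.B x = b * G.τ - b * x)
    (hdec : AntitoneOn (fun x => G.M x + G.B x) (Set.Ici 0)) {j i : Fin n}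
    (hint : Integrable (fun d => startTime G.c d j i) G.lat) :
    Integrable (fun d => G.M (startTime G.c d j i)) G.lat := by
  refine ((integrable_const (G.M 0)).add (hint.const_mul b)).mono'
    (measurable_M_startTime hc1 hcn hM j i).aestronglyMeasurable (ae_of_all _ fun d => ?_)
  have hs := startTime_nonneg G.c d j i
  rw [Real.norm_of_nonneg (hM0 _ hs)]
  simpa using M_add_le hB hdec le_rfl hs

theorem measurable_B_vote (hc1 : 1 ≤ G.c) (hcn : G.c ≤ n) (hmn : G.m ≤ n - 1)
    (hm : n - G.c < G.m) (hB : ∀ x, 0 ≤ x → G.B x = b * G.τ - b * x) (j i : Fin n) :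
    Measurable fun d : Draw n × Draw n =>
      G.B (startTime G.c d.1 j i + voteError G.m d.1 d.2 j i) := by
  have h : Measurable fun d : Draw n × Draw n =>
      b * G.τ - b * (startTime G.c d.1 j i + voteError G.m d.1 d.2 j i) :=
    measurable_const.sub ((((measurable_startTime hc1 hcn j i).comp measurable_fst).add
      (measurable_voteError (by omega) hmn j i)).const_mul b)
  convert h using 2 with d
  exact hB _ (startTime_add_voteError_nonneg hc1 hcn hmn hm _ _ j i)

theorem B_vote_nonneg (hc1 : 1 ≤ G.c) (hcn : G.c ≤ n) (hmn : G.m ≤ n - 1) (hm : n - G.c < G.m)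
    (hb : 0 ≤ b) (hB : ∀ x, 0 ≤ x → G.B x = b * G.τ - b * x) {j i : Fin n} {d : Draw n × Draw n}
    (h : startTime G.c d.1 j i + voteError G.m d.1 d.2 j i ≤ G.τ) :
    0 ≤ G.B (startTime G.c d.1 j i + voteError G.m d.1 d.2 j i) := by
  rw [hB _ (startTime_add_voteError_nonneg hc1 hcn hmn hm _ _ j i), ← mul_sub]
  exact mul_nonneg hb (sub_nonneg.2 h)

theorem integrable_B_vote [IsProbabilityMeasure G.lat] (hc1 : 1 ≤ G.c) (hcn : G.c ≤ n)
    (hmn : G.m ≤ n - 1) (hm : n - G.c < G.m) (hb : 0 ≤ b)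
    (hB : ∀ x, 0 ≤ x → G.B x = b * G.τ - b * x) {j i : Fin n}
    (hvote : ∀ᵐ d ∂G.lat.prod G.lat,
      startTime G.c d.1 j i + voteError G.m d.1 d.2 j i ≤ G.τ) :
    Integrable (fun d : Draw n × Draw n =>
      G.B (startTime G.c d.1 j i + voteError G.m d.1 d.2 j i)) (G.lat.prod G.lat) := by
  -- The aggregated vote lies in `[0, τ]` almost surely, so boundedness replaces integrability of
  -- the vote error.
  refine Integrable.of_mem_Icc 0 (b * G.τ)
    (measurable_B_vote hc1 hcn hmn hm hB j i).aemeasurable ?_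
  filter_upwards [hvote] with d hd
  have h0 := startTime_add_voteError_nonneg hc1 hcn hmn hm d.1 d.2 j i
  refine ⟨B_vote_nonneg hc1 hcn hmn hm hb hB hd, ?_⟩
  rw [hB _ h0]
  exact sub_le_self _ (mul_nonneg hb h0)

end Reference

/-! ### Comparison of plays -/

section Comparison

variable {G : Game n} {N : ℕ} {p : ℕ → Action n} {ω : ℕ → Move n} {i : Fin n} {b : ℝ} {r : ℕ}

theorem duration_play_truthful (hr : N ≤ 2 * (r + 1)) :
    duration G ω (play G N p (truthfulProfile n) ω) (r + 1) =
      alongMoves (promptDuration G) (ω r, ω (r + 1)) := by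
  rw [duration, play_truthful_fst hr, zero_add]
  rfl

theorem le_duration_play (σ : Profile n) (hr : N ≤ 2 * (r + 1)) :
    alongMoves (promptDuration G) (ω r, ω (r + 1)) ≤
      duration G ω (play G N p σ ω) (r + 1) :=
  le_add_of_nonneg_left (play_fst_nonneg hr)

theorem reward_play_truthful (hr : N ≤ 2 * (r + 1)) (hm1 : 1 ≤ G.m) (hmn : G.m ≤ n - 1) :
    (if (ω (r + 1)).1 = i then leaderReward G ω (play G N p (truthfulProfile n) ω) (r + 1) else 0) =
      alongMoves (promptReward G i) (ω r, ω (r + 1)) := by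
  unfold alongMoves promptReward
  split_ifs with h
  · rw [leaderReward, aggregatedVote_play_succ (hr.trans (by omega)) hm1 hmn fun _ _ => by rfl,
      duration_play_truthful hr]
    rfl
  · rfl

/-- Delaying does not raise the reward of a leader whose voters are truthful. -/
theorem reward_play_le (hc1 : 1 ≤ G.c) (hcn : G.c ≤ n) (hmn : G.m ≤ n - 1) (hm : n - G.c < G.m)
    (hB : ∀ x, 0 ≤ x → G.B x = b * G.τ - b * x)
    (hdec : AntitoneOn (fun x => G.M x + G.B x) (Set.Ici 0)) (s : Strategy n)
    (hr : N ≤ 2 * (r + 1)) :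
    (if (ω (r + 1)).1 = i then
        leaderReward G ω (play G N p (Function.update (truthfulProfile n) i s) ω) (r + 1) else 0) ≤
      alongMoves (promptReward G i) (ω r, ω (r + 1)) := by
  unfold alongMoves promptReward
  split_ifs with h
  · rw [leaderReward, aggregatedVote_play_succ (hr.trans (by omega)) (by omega) hmn
      fun k hk => by rw [Function.update_of_ne (h ▸ hk), truthfulProfile]]
    have hδ := play_fst_nonneg (G := G) (p := p) (ω := ω)
      (σ := Function.update (truthfulProfile n) i s) hr
    have hs := startTime_nonneg G.c (ω r).2 (ω r).1 (ω (r + 1)).1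
    have hv := startTime_add_voteError_nonneg hc1 hcn hmn hm (ω r).2 (ω (r + 1)).2 (ω r).1
      (ω (r + 1)).1
    have hM := M_add_le hB hdec hs hδ
    simp only [duration, start, add_assoc]
    -- Both votes are nonnegative, so `B` drops by exactly `b * δ`, which covers the gain in `M`.
    rw [hB _ hv, hB _ (add_nonneg hδ hv)]
    linarith
  · exact le_rfl

theorem splice_of_lt {K q : ℕ} {ω₀ : ℕ → Move n} (h : K < q) : splice K ω₀ ω q = ω q :=
  if_neg (Nat.not_le.2 h)

variable {a d : ℝ}

theorem tendsto_averageReward_truthful (hm1 : 1 ≤ G.m) (hmn : G.m ≤ n - 1) (hd : 0 < d)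
    {ω' : ℕ → Move n} {K : ℕ} (hK : N ≤ 2 * (K + 1)) (hω : ∀ q, K < q → ω' q = ω q)
    (hX : Tendsto (fun R : ℕ => (∑ r ∈ Finset.range R,
      alongMoves (promptReward G i) (ω r, ω (r + 1))) / R) atTop (𝓝 a))
    (hY : Tendsto (fun R : ℕ => (∑ r ∈ Finset.range R,
      alongMoves (promptDuration G) (ω r, ω (r + 1))) / R) atTop (𝓝 d)) :
    Tendsto (averageReward G i ω' (play G N p (truthfulProfile n) ω')) atTop (𝓝 (a / d)) := by
  -- Round `q + 1` involves moves `q` and `q + 1`; both must come after `K`, hence the threshold `K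
  -- + 1`.
  have h1 := tendsto_average_of_eventually_succ_eq (K := K + 1) hX
    (y := fun q => if (ω' q).1 = i then
      leaderReward G ω' (play G N p (truthfulProfile n) ω') q else 0) fun q hq => by
    rw [reward_play_truthful (by omega) hm1 hmn, hω q (by omega), hω (q + 1) (by omega)]
  have h2 := tendsto_average_of_eventually_succ_eq (K := K + 1) hY
    (y := duration G ω' (play G N p (truthfulProfile n) ω')) fun q hq => by
    rw [duration_play_truthful (by omega), hω q (by omega), hω (q + 1) (by omega)]
  refine (h1.div h2 hd.ne').congr' ?_
  filter_upwards [eventually_gt_atTop 0] with R hR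
  have : (R : ℝ) ≠ 0 := by positivity
  exact div_div_div_cancel_right₀ this _ _

theorem longRun_deviation_le (hc1 : 1 ≤ G.c) (hcn : G.c ≤ n) (hmn : G.m ≤ n - 1)
    (hm : n - G.c < G.m) (hB : ∀ x, 0 ≤ x → G.B x = b * G.τ - b * x)
    (hdec : AntitoneOn (fun x => G.M x + G.B x) (Set.Ici 0)) (hd : 0 < d) (s : Strategy n)
    {ω' : ℕ → Move n} {K : ℕ} (hK : N ≤ 2 * (K + 1)) (hω : ∀ q, K < q → ω' q = ω q)
    (h0 : ∀ r, 0 ≤ alongMoves (promptReward G i) (ω r, ω (r + 1)))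
    (hX : Tendsto (fun R : ℕ => (∑ r ∈ Finset.range R,
      alongMoves (promptReward G i) (ω r, ω (r + 1))) / R) atTop (𝓝 a))
    (hY : Tendsto (fun R : ℕ => (∑ r ∈ Finset.range R,
      alongMoves (promptDuration G) (ω r, ω (r + 1))) / R) atTop (𝓝 d)) :
    longRun G i ω' (play G N p (Function.update (truthfulProfile n) i s) ω') ≤ a / d := by
  set h := play G N p (Function.update (truthfulProfile n) i s) ω' with hh
  set t : ℕ → ℝ := fun q => if (ω' q).1 = i then leaderReward G ω' h q else 0 with ht
  -- The ratio comparison needs bounds in every round: `x` and `y` follow the reference late, and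
  -- early on dominate trivially with `x` kept nonnegative.
  set x : ℕ → ℝ := fun q => if K + 1 < q then
    alongMoves (promptReward G i) (ω (q - 1), ω (q - 1 + 1)) else |t q| with hx
  set y : ℕ → ℝ := fun q => if K + 1 < q then
    alongMoves (promptDuration G) (ω (q - 1), ω (q - 1 + 1)) else duration G ω' h q with hy
  have hx1 := tendsto_average_of_eventually_succ_eq (K := K + 1) hX (y := x) fun q hq => by
    simp only [hx, if_pos (Nat.lt_succ_of_le hq), Nat.add_sub_cancel]
  have hy1 := tendsto_average_of_eventually_succ_eq (K := K + 1) hY (y := y) fun q hq => by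
    simp only [hy, if_pos (Nat.lt_succ_of_le hq), Nat.add_sub_cancel]
  refine limsup_ratio_le (t := t) (d := duration G ω' h) (fun q => ?_) (fun q => ?_) (fun q => ?_)
    hd hx1 hy1
  · simp only [hx]
    split_ifs
    · exact h0 _
    · exact abs_nonneg _
  · simp only [hx]
    split_ifs with hq
    · obtain ⟨r, rfl⟩ : ∃ r, q = r + 1 := ⟨q - 1, by omega⟩
      rw [Nat.add_sub_cancel, ← hω r (by omega), ← hω (r + 1) (by omega)]
      exact reward_play_le hc1 hcn hmn hm hB hdec s (by omega)
    · exact le_abs_self _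
  · simp only [hy]
    split_ifs with hq
    · obtain ⟨r, rfl⟩ : ∃ r, q = r + 1 := ⟨q - 1, by omega⟩
      rw [Nat.add_sub_cancel, ← hω r (by omega), ← hω (r + 1) (by omega)]
      exact le_duration_play _ (by omega)
    · exact le_rfl

end Comparison

/-! ### Integration of comparisons that hold for every past -/

/-- Lifts almost sure facts about nature's future to an arbitrary belief about the past. -/
theorem ae_prod_of_ae_right {α β : Type*} [MeasurableSpace α] [MeasurableSpace β] {μ : Measure α}
    {ν : Measure β} [SFinite ν] {q : β → Prop} (h : ∀ᵐ y ∂ν, q y) : ∀ᵐ z ∂μ.prod ν, q z.2 :=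
  Measure.quasiMeasurePreserving_snd.ae h

/-- A possibly non-integrable function below a nonnegative constant has its integral below it. -/
theorem integral_le_of_ae_le_const {α : Type*} [MeasurableSpace α] {μ : Measure α}
    [IsProbabilityMeasure μ] {f : α → ℝ} {C : ℝ} (hC : 0 ≤ C) (h : ∀ᵐ x ∂μ, f x ≤ C) :
    ∫ x, f x ∂μ ≤ C := by
  by_cases hf : Integrable f μ
  · simpa using integral_mono_ae hf (integrable_const C) h
  · rwa [integral_undef hf]

end Timing

end

/-! ### Equilibrium and the value of the utility -/

open Timing in
theorem mainTheorem1 {n : ℕ} [NeZero n] (G : Game n) [IsProbabilityMeasure G.lat] (b : ℝ)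
    -- quorum size and rank of the order statistic
    (hc1 : 1 ≤ G.c) (hcn : G.c ≤ n) (hmn : G.m ≤ n - 1)
    -- `M` is nonnegative and increasing; `B` is linear and vanishes at the timeout
    (hM0 : ∀ x, 0 ≤ x → 0 ≤ G.M x) (hM : MonotoneOn G.M (Set.Ici 0))
    (hb : 0 ≤ b) (hB : ∀ x, 0 ≤ x → G.B x = b * G.τ - b * x)
    -- without delay no block times out, and the aggregated vote is at most the timeout
    (hfirst : ∀ i, ∀ᵐ d ∂G.lat, 0 ≤ maxDelayFirst G.τ G.c d i)
    (hcap : ∀ j i, ∀ᵐ d ∂G.lat.prod G.lat, 0 ≤ maxDelay G.τ G.c d.1 d.2 j i)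
    (hvote : ∀ j i, ∀ᵐ d ∂G.lat.prod G.lat,
      startTime G.c d.1 j i + voteError G.m d.1 d.2 j i ≤ G.τ)
    -- expected round durations are finite and not all zero
    (hint : ∀ j i, Integrable (fun d => startTime G.c d j i) G.lat)
    (hpos : 0 < ∑ j, ∑ k, ∫ d, startTime G.c d j k ∂G.lat)
    -- the hypotheses of the theorem
    (hdec : AntitoneOn (fun x => G.M x + G.B x) (Set.Ici 0)) (hm : n - G.c < G.m) :
    IsSubgamePerfectBayesNash G (truthfulProfile n) ∧
      ∀ i : Fin n,
        let U : ℝ :=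
          (∑ j, ((∫ d, G.M (startTime G.c d j i) ∂G.lat) +
              ∫ d, G.B (startTime G.c d.1 j i + voteError G.m d.1 d.2 j i)
                ∂(G.lat.prod G.lat))) /
            ∑ j, ∑ k, ∫ d, startTime G.c d j k ∂G.lat
        utility G (truthfulProfile n) i = U ∧
          ∀ᵐ ω ∂G.pathLaw,
            Tendsto (averageReward G i ω (play G 0 0 (truthfulProfile n) ω)) atTop (𝓝 U) := by
  have hm1 : 1 ≤ G.m := by omega
  have hn : (0 : ℝ) < n := by exact_mod_cast NeZero.pos n
  have hn2 : (0 : ℝ) < (n : ℝ)⁻¹ * (n : ℝ)⁻¹ := by positivity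
  have hSm := fun j i => measurable_startTime (n := n) hc1 hcn j i
  have hMm := fun j i => measurable_M_startTime hc1 hcn hM j i
  have hMi := fun j i => integrable_M_startTime hc1 hcn hM0 hM hB hdec (hint j i)
  have hBm := fun j i => measurable_B_vote hc1 hcn hmn hm hB j i
  have hBi := fun j i => integrable_B_vote hc1 hcn hmn hm hb hB (hvote j i)
  have hdur := ae_tendsto_average_alongMoves G (f := promptDuration G)
    (fun j k => (hSm j k).comp measurable_fst) fun j k => (hint j k).comp_fst G.lat
  have hrew := fun i => ae_tendsto_average_alongMoves G (f := promptReward G i)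
    (fun j k => by
      unfold promptReward
      split_ifs
      · exact ((hMm j k).comp measurable_fst).add (hBm j k)
      · exact measurable_const)
    (fun j k => by
      unfold promptReward
      split_ifs
      · exact ((hMi j k).comp_fst G.lat).add (hBi j k)
      · exact integrable_zero _ _ _)
  have hdurE : ∀ j k, ∫ d, promptDuration G j k d ∂G.lat.prod G.lat =
      ∫ d, startTime G.c d j k ∂G.lat := fun j k => by
    simpa [promptDuration] using
      integral_fun_fst (μ := G.lat) (ν := G.lat) fun d => startTime G.c d j k
  have hrewE : ∀ i j, ∑ k, ∫ d, promptReward G i j k d ∂G.lat.prod G.lat =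
      (∫ d, G.M (startTime G.c d j i) ∂G.lat) +
        ∫ d, G.B (startTime G.c d.1 j i + voteError G.m d.1 d.2 j i) ∂(G.lat.prod G.lat) := by
    intro i j
    -- Validator `i` is paid only in rounds led by `i`, so the sum over the second leader collapses.
    rw [Finset.sum_eq_single i (fun k _ hk => by simp [promptReward, hk]) (by simp)]
    simp only [promptReward, if_true]
    rw [integral_add ((hMi j i).comp_fst G.lat) (hBi j i)]
    congr 1
    simpa using integral_fun_fst (μ := G.lat) (ν := G.lat) fun d => G.M (startTime G.c d j i)
  simp only [hdurE] at hdur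
  simp only [hrewE] at hrew
  have hd := mul_pos hn2 hpos
  have h0 : ∀ i, ∀ᵐ ω ∂G.pathLaw, ∀ r, 0 ≤ alongMoves (promptReward G i) (ω r, ω (r + 1)) := by
    intro i
    have hvote' : ∀ᵐ d ∂G.lat.prod G.lat, ∀ j k,
        startTime G.c d.1 j k + voteError G.m d.1 d.2 j k ≤ G.τ :=
      ae_all_iff.2 fun j => ae_all_iff.2 fun k => hvote j k
    filter_upwards [ae_pathLaw_consecutive G hvote'] with ω hω r
    unfold alongMoves promptReward
    split_ifs
    · exact add_nonneg (hM0 _ (startTime_nonneg _ _ _ _))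
        (B_vote_nonneg hc1 hcn hmn hm hb hB (hω r _ _))
    · exact le_rfl
  refine ⟨fun N β hβ i s => ?_, fun i => ?_⟩
  -- Node `N` lies in round `N / 2`; from the next round on, delays and moves are free of the past.
  · have hK : N ≤ 2 * (N / 2 + 1) := by omega
    have htruth : continuationUtility G N β (truthfulProfile n) i = _ :=
      (integral_congr_ae (by
        filter_upwards [ae_prod_of_ae_right (μ := β) hdur, ae_prod_of_ae_right (μ := β) (hrew i)]
          with z hz1 hz2
        exact (tendsto_averageReward_truthful hm1 hmn hd hK (fun q hq => splice_of_lt hq)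
          hz2 hz1).limsup_eq)).trans (integral_const _)
    rw [htruth, probReal_univ, one_smul]
    refine integral_le_of_ae_le_const (div_nonneg ?_ hd.le) ?_
    -- The limit is a constant, so its sign can be read off a single typical path.
    · obtain ⟨ω, hω0, hω⟩ := ((h0 i).and (hrew i)).exists
      exact ge_of_tendsto' hω fun R =>
        div_nonneg (Finset.sum_nonneg fun r _ => hω0 r) (Nat.cast_nonneg R)
    · filter_upwards [ae_prod_of_ae_right (μ := β) hdur, ae_prod_of_ae_right (μ := β) (hrew i),
        ae_prod_of_ae_right (μ := β) (h0 i)] with z hz1 hz2 hz0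
      exact longRun_deviation_le hc1 hcn hmn hm hB hdec hd s hK (fun q hq => splice_of_lt hq) hz0
        hz2 hz1
  · intro U
    have hlim : ∀ᵐ ω ∂G.pathLaw,
        Tendsto (averageReward G i ω (play G 0 0 (truthfulProfile n) ω)) atTop (𝓝 U) := by
      filter_upwards [hdur, hrew i] with ω h1 h2
      have := tendsto_averageReward_truthful (N := 0) (p := 0) (K := 0) hm1 hmn hd (Nat.zero_le _)
        (fun q _ => rfl) h2 h1
      -- The factor `1 / n ^ 2` for the pair of leaders cancels between reward and duration.
      rwa [mul_div_mul_left _ _ hn2.ne'] at this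
    refine ⟨?_, hlim⟩
    have : utility G (truthfulProfile n) i = ∫ _, U ∂G.pathLaw :=
      integral_congr_ae (hlim.mono fun ω hω => hω.limsup_eq)
    rw [this, integral_const, probReal_univ, one_smul]
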